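/- **Theorem (LKSI convergence).** Let $d\ge 1$, let $\omega\subset\mathbb R^d$ be a bounded open set, and let $\kappa:\omega\to\mathbb R$ be measurable with $\kappa_{\min}\le\kappa(x)\le\kappa_{\max}$ for almost every $x\in\omega$, where $0<\kappa_{\min}\le\kappa_{\max}<\infty$. On $V(\omega)=H^1_0(\omega)$ put $a(u,v)=\int_\omega \kappa\,\nabla u\cdot\nabla v\,dx$ and $\|v\|_a=a(v,v)^{1/2}$, and let $\mathcal L^{-1}:L^2(\omega)\to V(\omega)$ be the local inverse operator: $\mathcal L^{-1}f$ is the unique $u\in V(\omega)$ with $a(u,v)=\int_\omega f v\,dx$ for all $v\in V(\omega)$. Let $(\lambda^j,\phi^j)$, $j=1,2,3,\dots$, be all the eigenpairs of $\mathcal L^{-1}$ in $V(\omega)$, listed with multiplicity so that $\lambda^1\ge\lambda^2\ge\lambda^3\ge\cdots\ge 0$, with nonzero, mutually $a$-orthogonal eigenfunctions $\phi^j$. For $\psi\in V(\omega)$ and $k\ge 1$ let $$\mathcal K_k(\mathcal L^{-1},\psi)=\operatorname{span}\{\psi,\mathcal L^{-1}\psi,\dots,\mathcal L^{-(k-1)}\psi\}.$$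 Fix $j\ge1$ with $\lambda^m\ne\lambda^j$ for all $m<j$, and let $\psi^0\in V(\omega)$ have a nonzero component along $\phi^j$, that is, $a(\psi^0,\phi^j)\neq0$. Then there is a constant $C$, independent of $k$, such that for every $k>j$ there exists $\hat\phi^{j,k}\in\mathcal K_k(\mathcal L^{-1},\psi^0)$ with $$\|\hat\phi^{j,k}-\phi^j\|_a\le C\left(\frac{1}{1+4\gamma^j}\right)^k,\qquad \gamma^j=\frac{\lambda^j-\lambda^{j+1}}{\lambda^{j+1}} .$$ -/

import Mathlib

noncomputable section

open MeasureTheory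
open scoped Gradient InnerProductSpace

namespace LKSI

/-- `ℝᵈ` with the Euclidean norm. -/
abbrev Space (d : ℕ) : Type := EuclideanSpace ℝ (Fin d)

/-- `L²(ω)`. -/
abbrev L2 {d : ℕ} (ω : Set (Space d)) : Type :=
  Lp ℝ 2 ((volume : Measure (Space d)).restrict ω)

/-- `L²(ω; ℝᵈ)`. -/
abbrev L2Vec {d : ℕ} (ω : Set (Space d)) : Type :=
  Lp (Space d) 2 ((volume : Measure (Space d)).restrict ω)

/-- The Hilbert space `L²(ω) × L²(ω; ℝᵈ)`; a Sobolev function `u` is represented in it by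
`(u, ∇u)`, and the norm of this pair is the `H¹(ω)` norm of `u`. -/
abbrev L2Pair {d : ℕ} (ω : Set (Space d)) : Type := WithLp 2 (L2 ω × L2Vec ω)

/-- `f ∈ C_c^∞(ω)`. -/
structure IsTestFunction {d : ℕ} (ω : Set (Space d)) (f : Space d → ℝ) : Prop where
  smooth : ContDiff ℝ (⊤ : ℕ∞) f
  hasCompactSupport : HasCompactSupport f
  tsupport_subset : tsupport f ⊆ ω

theorem gradient_add' {d : ℕ} {f g : Space d → ℝ} (hf : ContDiff ℝ (⊤ : ℕ∞) f) (hg : ContDiff ℝ (⊤ : ℕ∞) g)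
    (x : Space d) : ∇ (f + g) x = ∇ f x + ∇ g x := by
  have h1 : DifferentiableAt ℝ f x := (hf.differentiable (by simp)).differentiableAt
  have h2 : DifferentiableAt ℝ g x := (hg.differentiable (by simp)).differentiableAt
  simp only [gradient]
  rw [fderiv_add h1 h2, map_add]

theorem gradient_smul' {d : ℕ} {f : Space d → ℝ} (hf : ContDiff ℝ (⊤ : ℕ∞) f) (c : ℝ)
    (x : Space d) : ∇ (c • f) x = c • ∇ f x := by
  have h1 : DifferentiableAt ℝ f x := (hf.differentiable (by simp)).differentiableAt
  simp only [gradient]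
  rw [fderiv_const_smul h1]
  simp

/-- The pairs `(f, ∇f)` with `f ∈ C_c^∞(ω)`. -/
def testPairs {d : ℕ} (ω : Set (Space d)) : Submodule ℝ (L2Pair ω) where
  carrier := {p | ∃ f : Space d → ℝ, IsTestFunction ω f ∧
    p.fst =ᵐ[(volume : Measure (Space d)).restrict ω] f ∧
    p.snd =ᵐ[(volume : Measure (Space d)).restrict ω] ∇ f}
  zero_mem' := by
    refine ⟨0, ⟨contDiff_const, HasCompactSupport.zero, by simp [tsupport]⟩, ?_, ?_⟩
    · exact Lp.coeFn_zero _ _ _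
    · refine (Lp.coeFn_zero _ _ _).trans ?_
      filter_upwards with x
      simp [gradient]
  add_mem' := by
    rintro p q ⟨f, hf, hf1, hf2⟩ ⟨g, hg, hg1, hg2⟩
    refine ⟨f + g, ⟨hf.smooth.add hg.smooth, hf.hasCompactSupport.add hg.hasCompactSupport, ?_⟩,
      ?_, ?_⟩
    · exact (tsupport_add f g).trans
        (Set.union_subset hf.tsupport_subset hg.tsupport_subset)
    · exact (Lp.coeFn_add _ _).trans (hf1.add hg1)
    · refine (Lp.coeFn_add _ _).trans ((hf2.add hg2).trans ?_)
      filter_upwards with x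
      exact (gradient_add' hf.smooth hg.smooth x).symm
  smul_mem' := by
    rintro c p ⟨f, hf, hf1, hf2⟩
    refine ⟨c • f, ⟨hf.smooth.const_smul c, hf.hasCompactSupport.smul_left (f := fun _ => c), ?_⟩,
      ?_, ?_⟩
    · exact (closure_mono (Function.support_const_smul_subset c f)).trans hf.tsupport_subset
    · exact (Lp.coeFn_smul _ _).trans (hf1.const_smul c)
    · refine (Lp.coeFn_smul _ _).trans ((hf2.const_smul c).trans ?_)
      filter_upwards with x
      exact (gradient_smul' hf.smooth c x).symm

/-- The Sobolev space `H¹₀(ω)`: the closure of `C_c^∞(ω)` in the `H¹` norm. -/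
def H10 {d : ℕ} (ω : Set (Space d)) : Submodule ℝ (L2Pair ω) :=
  (testPairs ω).topologicalClosure

instance {d : ℕ} (ω : Set (Space d)) : CompleteSpace (H10 ω) :=
  (testPairs ω).isClosed_topologicalClosure.completeSpace_coe

/-- The inclusion `H¹₀(ω) → L²(ω)`. -/
def toL2 {d : ℕ} (ω : Set (Space d)) : H10 ω →L[ℝ] L2 ω :=
  (WithLp.fstL 2 ℝ (L2 ω) (L2Vec ω)).comp (H10 ω).subtypeL

/-- The weak gradient `H¹₀(ω) → L²(ω; ℝᵈ)`. -/
def grad {d : ℕ} (ω : Set (Space d)) : H10 ω →L[ℝ] L2Vec ω :=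
  (WithLp.sndL 2 ℝ (L2 ω) (L2Vec ω)).comp (H10 ω).subtypeL

/-- `κ` is a measurable coefficient, bounded and uniformly positive almost everywhere on `ω`. -/
structure IsPermeability {d : ℕ} (ω : Set (Space d)) (κ : Space d → ℝ) : Prop where
  aemeasurable : AEMeasurable κ ((volume : Measure (Space d)).restrict ω)
  bounds : ∃ κmin κmax : ℝ, 0 < κmin ∧
    ∀ᵐ x ∂(volume : Measure (Space d)).restrict ω, κmin ≤ κ x ∧ κ x ≤ κmax

/-- The energy form `a(u, v) = ∫_ω κ ∇u · ∇v dx`. -/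
def energy {d : ℕ} (ω : Set (Space d)) (κ : Space d → ℝ) (u v : H10 ω) : ℝ :=
  ∫ x in ω, κ x * ⟪grad ω u x, grad ω v x⟫_ℝ

/-- The energy norm `‖v‖_a = a(v, v)^{1/2}`. -/
def energyNorm {d : ℕ} (ω : Set (Space d)) (κ : Space d → ℝ) (v : H10 ω) : ℝ :=
  √(energy ω κ v v)

section Energy

variable {d : ℕ} {ω : Set (Space d)} {κ : Space d → ℝ}

theorem integrable_energy (hκ : IsPermeability ω κ) (u v : H10 ω) :
    Integrable (fun x => κ x * ⟪grad ω u x, grad ω v x⟫_ℝ)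
      ((volume : Measure (Space d)).restrict ω) := by
  obtain ⟨m, M, hm, hb⟩ := hκ.bounds
  refine (L2.integrable_inner (𝕜 := ℝ) (grad ω u) (grad ω v)).bdd_mul (c := M)
    hκ.aemeasurable.aestronglyMeasurable ?_
  filter_upwards [hb] with x hx
  rw [Real.norm_eq_abs, abs_of_nonneg (hm.le.trans hx.1)]
  exact hx.2

theorem energy_add_left (hκ : IsPermeability ω κ) (u u' v : H10 ω) :
    energy ω κ (u + u') v = energy ω κ u v + energy ω κ u' v := by
  unfold energy
  rw [← integral_add (integrable_energy hκ u v) (integrable_energy hκ u' v)]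
  refine integral_congr_ae ?_
  rw [map_add]
  filter_upwards [Lp.coeFn_add (grad ω u) (grad ω u')] with x hx
  rw [hx, Pi.add_apply, inner_add_left, mul_add]

theorem energy_smul_left (c : ℝ) (u v : H10 ω) :
    energy ω κ (c • u) v = c * energy ω κ u v := by
  unfold energy
  rw [← integral_const_mul]
  refine integral_congr_ae ?_
  rw [map_smul]
  filter_upwards [Lp.coeFn_smul c (grad ω u)] with x hx
  rw [hx, Pi.smul_apply, real_inner_smul_left]
  ring

theorem energy_comm (u v : H10 ω) : energy ω κ u v = energy ω κ v u := by
  refine integral_congr_ae (Filter.Eventually.of_forall fun x => ?_)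
  exact congrArg (κ x * ·) (real_inner_comm _ _)

theorem norm_grad_le (u : H10 ω) : ‖grad ω u‖ ≤ ‖u‖ :=
  WithLp.norm_snd_le _ (u : L2Pair ω)

theorem exists_energy_bound (hκ : IsPermeability ω κ) :
    ∃ M : ℝ, ∀ u v : H10 ω, ‖energy ω κ u v‖ ≤ M * ‖u‖ * ‖v‖ := by
  obtain ⟨m, M, hm, hb⟩ := hκ.bounds
  refine ⟨|M|, fun u v => ?_⟩
  have h1 : ‖energy ω κ u v‖ ≤ ∫ x in ω, |M| * (‖grad ω u x‖ * ‖grad ω v x‖) := by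
    refine norm_integral_le_of_norm_le ?_ ?_
    · exact ((Lp.memLp (grad ω u)).norm.integrable_mul (Lp.memLp (grad ω v)).norm).const_mul _
    · filter_upwards [hb] with x hx
      rw [norm_mul, Real.norm_eq_abs, abs_of_nonneg (hm.le.trans hx.1)]
      exact mul_le_mul (hx.2.trans (le_abs_self M)) (norm_inner_le_norm _ _) (norm_nonneg _)
        (abs_nonneg _)
  have h2 : ∫ x in ω, ‖grad ω u x‖ * ‖grad ω v x‖ ≤ ‖grad ω u‖ * ‖grad ω v‖ := by
    have hu := (Lp.memLp (grad ω u)).norm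
    have hv := (Lp.memLp (grad ω v)).norm
    have h3 := real_inner_le_norm hu.toLp hv.toLp
    rw [L2.inner_def] at h3
    have h4 : ‖hu.toLp‖ = ‖grad ω u‖ := by
      rw [Lp.norm_toLp, Lp.norm_def, eLpNorm_norm]
    have h5 : ‖hv.toLp‖ = ‖grad ω v‖ := by
      rw [Lp.norm_toLp, Lp.norm_def, eLpNorm_norm]
    rw [h4, h5] at h3
    refine le_of_eq_of_le (integral_congr_ae ?_) h3
    filter_upwards [hu.coeFn_toLp, hv.coeFn_toLp] with x h6 h7
    rw [h6, h7]
    exact mul_comm _ _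
  rw [integral_const_mul] at h1
  calc ‖energy ω κ u v‖ ≤ |M| * (‖grad ω u‖ * ‖grad ω v‖) :=
        h1.trans (mul_le_mul_of_nonneg_left h2 (abs_nonneg _))
    _ ≤ |M| * (‖u‖ * ‖v‖) := by
        gcongr
        · exact norm_grad_le u
        · exact norm_grad_le v
    _ = |M| * ‖u‖ * ‖v‖ := by ring

end Energy

/-- The energy form as a bounded bilinear form on `H¹₀(ω)`. -/
def energyForm {d : ℕ} {ω : Set (Space d)} {κ : Space d → ℝ} (hκ : IsPermeability ω κ) :
    H10 ω →L[ℝ] H10 ω →L[ℝ] ℝ :=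
  LinearMap.mkContinuous₂ (LinearMap.mk₂ ℝ (energy ω κ)
    (energy_add_left hκ) energy_smul_left
    (fun u v w => by
      rw [energy_comm, energy_add_left hκ, energy_comm v, energy_comm w])
    (fun c u v => by rw [energy_comm, energy_smul_left, energy_comm v]; rfl))
    (exists_energy_bound hκ).choose (exists_energy_bound hκ).choose_spec

theorem energyForm_apply {d : ℕ} {ω : Set (Space d)} {κ : Space d → ℝ}
    (hκ : IsPermeability ω κ) (u v : H10 ω) : energyForm hκ u v = energy ω κ u v := rfl

section Poincare

variable {d : ℕ} {ω : Set (Space d)} {κ : Space d → ℝ}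

theorem exists_direction [NeZero d] : ∃ (e : Space d) (p : Space d →L[ℝ] ℝ),
    p e = 1 ∧ ‖e‖ = 1 ∧ ∀ x, |p x| ≤ ‖x‖ :=
  ⟨EuclideanSpace.single 0 1, EuclideanSpace.proj (0 : Fin d), by simp, by simp,
    fun x => PiLp.norm_apply_le x (0 : Fin d)⟩

theorem poincare_test [NeZero d] {R : ℝ} (hR : ∀ x ∈ ω, ‖x‖ ≤ R)
    {f : Space d → ℝ} (hf : IsTestFunction ω f) :
    ∫ x in ω, f x ^ 2 ≤ 4 * R ^ 2 * ∫ x in ω, ‖∇ f x‖ ^ 2 := by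
  have hf0 : ∀ x, x ∉ ω → f x = 0 := fun x hx =>
    image_eq_zero_of_notMem_tsupport (fun h => hx (hf.tsupport_subset h))
  have hg0 : ∀ x, x ∉ ω → fderiv ℝ f x = 0 := fun x hx => by
    by_contra h
    exact hx (hf.tsupport_subset (support_fderiv_subset ℝ (Function.mem_support.2 h)))
  have hgn : ∀ x, ‖∇ f x‖ = ‖fderiv ℝ f x‖ := fun x => by simp [gradient]
  rw [setIntegral_eq_integral_of_forall_compl_eq_zero
      (fun x hx => by rw [hf0 x hx]; norm_num),
    setIntegral_eq_integral_of_forall_compl_eq_zero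
      (fun x hx => by rw [hgn, hg0 x hx]; simp)]
  simp only [hgn]
  have hfc := hf.hasCompactSupport
  have hcf : Continuous f := hf.smooth.continuous
  have hdf : Differentiable ℝ f := hf.smooth.differentiable (by simp)
  have hcd : Continuous (fderiv ℝ f) := hf.smooth.continuous_fderiv (by simp)
  obtain ⟨e, p, hpe, hen, hpn⟩ := exists_direction (d := d)
  have hd2 : ∀ x, fderiv ℝ (fun y => f y ^ 2) x e = 2 * f x * fderiv ℝ f x e := fun x => by
    rw [((hdf x).hasFDerivAt.pow 2).fderiv]
    simp
  have hce : Continuous (fun x => fderiv ℝ f x e) := hcd.clm_apply continuous_const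
  have hi2 : Integrable (fun x => f x ^ 2) (volume : Measure (Space d)) :=
    (hcf.pow 2).integrable_of_hasCompactSupport
      (hfc.mono fun x hx h => hx (by simp [h]))
  have hi3 : Integrable (fun x => ‖fderiv ℝ f x‖ ^ 2) (volume : Measure (Space d)) :=
    (hcd.norm.pow 2).integrable_of_hasCompactSupport
      ((hfc.fderiv ℝ).mono fun x hx h => hx (by simp [h]))
  have hi4 : Integrable (fun x => p x * (2 * f x * fderiv ℝ f x e))
      (volume : Measure (Space d)) :=
    (p.continuous.mul ((continuous_const.mul hcf).mul hce)).integrable_of_hasCompactSupport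
      (hfc.mono fun x hx h => hx (by simp [h]))
  have hi5 : Integrable (fun x => p x * f x ^ 2) (volume : Measure (Space d)) :=
    (p.continuous.mul (hcf.pow 2)).integrable_of_hasCompactSupport
      (hfc.mono fun x hx h => hx (by simp [h]))
  have key : ∫ x, p x * (2 * f x * fderiv ℝ f x e) = - ∫ x, f x ^ 2 := by
    have h := integral_mul_fderiv_eq_neg_fderiv_mul_of_integrable
      (μ := (volume : Measure (Space d))) (f := fun x => p x) (g := fun x => f x ^ 2) (v := e)
      (by simpa [hpe] using hi2) (by simpa only [hd2] using hi4) hi5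
      (fun x _ => p.differentiableAt) (fun x _ => (hdf x).pow 2)
    simp only [hd2] at h
    rw [h]
    simp [hpe]
  have hpt : ∀ x, -(p x * (2 * f x * fderiv ℝ f x e)) ≤
      f x ^ 2 / 2 + 2 * R ^ 2 * ‖fderiv ℝ f x‖ ^ 2 := fun x => by
    by_cases hx : x ∈ ω
    · have h1 : |fderiv ℝ f x e| ≤ ‖fderiv ℝ f x‖ := by
        simpa [hen] using (fderiv ℝ f x).le_opNorm e
      have h2 : |p x| ≤ R := (hpn x).trans (hR x hx)
      have h3 : (p x * fderiv ℝ f x e) ^ 2 ≤ R ^ 2 * ‖fderiv ℝ f x‖ ^ 2 := by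
        rw [← mul_pow, ← sq_abs, abs_mul]
        exact pow_le_pow_left₀ (mul_nonneg (abs_nonneg _) (abs_nonneg _))
          (mul_le_mul h2 h1 (abs_nonneg _) ((abs_nonneg _).trans h2)) 2
      nlinarith [sq_nonneg (f x + 2 * (p x * fderiv ℝ f x e))]
    · rw [hf0 x hx]
      have : 0 ≤ 2 * R ^ 2 * ‖fderiv ℝ f x‖ ^ 2 := by positivity
      simpa using this
  have hmono := integral_mono hi4.neg ((hi2.div_const 2).add (hi3.const_mul (2 * R ^ 2))) hpt
  simp only [Pi.neg_apply, Pi.add_apply] at hmono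
  rw [integral_neg, key, integral_add (hi2.div_const 2) (hi3.const_mul (2 * R ^ 2)),
    integral_div, integral_const_mul] at hmono
  linarith

theorem norm_sq_eq_integral {F : Type*} [NormedAddCommGroup F] [InnerProductSpace ℝ F]
    (u : Lp F 2 ((volume : Measure (Space d)).restrict ω)) :
    ‖u‖ ^ 2 = ∫ x in ω, ‖u x‖ ^ 2 := by
  rw [← real_inner_self_eq_norm_sq, L2.inner_def]
  simp only [real_inner_self_eq_norm_sq]

theorem poincare [NeZero d] {R : ℝ} (hR : ∀ x ∈ ω, ‖x‖ ≤ R) (u : H10 ω) :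
    ‖toL2 ω u‖ ^ 2 ≤ 4 * R ^ 2 * ‖grad ω u‖ ^ 2 := by
  have hcl : IsClosed {p : L2Pair ω | ‖p.fst‖ ^ 2 ≤ 4 * R ^ 2 * ‖p.snd‖ ^ 2} := by
    refine isClosed_le ?_ ?_
    · exact ((WithLp.fstL 2 ℝ (L2 ω) (L2Vec ω)).continuous.norm).pow 2
    · exact continuous_const.mul (((WithLp.sndL 2 ℝ (L2 ω) (L2Vec ω)).continuous.norm).pow 2)
  have hsub : (testPairs ω : Set (L2Pair ω)) ⊆
      {p : L2Pair ω | ‖p.fst‖ ^ 2 ≤ 4 * R ^ 2 * ‖p.snd‖ ^ 2} := by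
    rintro q ⟨f, hf, h1, h2⟩
    have e1 : ‖q.fst‖ ^ 2 = ∫ x in ω, f x ^ 2 := by
      rw [norm_sq_eq_integral]
      refine integral_congr_ae ?_
      filter_upwards [h1] with x hx
      rw [hx, Real.norm_eq_abs, sq_abs]
    have e2 : ‖q.snd‖ ^ 2 = ∫ x in ω, ‖∇ f x‖ ^ 2 := by
      rw [norm_sq_eq_integral]
      refine integral_congr_ae ?_
      filter_upwards [h2] with x hx
      rw [hx]
    show ‖q.fst‖ ^ 2 ≤ 4 * R ^ 2 * ‖q.snd‖ ^ 2
    rw [e1, e2]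
    exact poincare_test hR hf
  exact closure_minimal hsub hcl u.2

theorem energyForm_isCoercive [NeZero d] (hω : Bornology.IsBounded ω)
    (hκ : IsPermeability ω κ) : IsCoercive (energyForm hκ) := by
  obtain ⟨R, hR⟩ := hω.exists_norm_le
  obtain ⟨m, M, hm, hb⟩ := hκ.bounds
  refine ⟨m / (4 * R ^ 2 + 1), by positivity, fun u => ?_⟩
  have h1 : m * ‖grad ω u‖ ^ 2 ≤ energy ω κ u u := by
    rw [norm_sq_eq_integral, ← integral_const_mul]
    refine integral_mono_ae ?_ (integrable_energy hκ u u) ?_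
    · exact ((Lp.memLp (grad ω u)).integrable_norm_pow (by norm_num)).const_mul m
    · filter_upwards [hb] with x hx
      show m * ‖grad ω u x‖ ^ 2 ≤ κ x * ⟪grad ω u x, grad ω u x⟫_ℝ
      rw [real_inner_self_eq_norm_sq]
      exact mul_le_mul_of_nonneg_right hx.1 (sq_nonneg _)
  have h2 : ‖u‖ ^ 2 = ‖toL2 ω u‖ ^ 2 + ‖grad ω u‖ ^ 2 :=
    WithLp.prod_norm_sq_eq_of_L2 (u : L2Pair ω)
  have h3 := poincare hR u
  rw [energyForm_apply, mul_assoc, ← sq, div_mul_eq_mul_div, div_le_iff₀ (by positivity), h2]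
  nlinarith [sq_nonneg R]

end Poincare

section Operator

variable {d : ℕ} [NeZero d] {ω : Set (Space d)} {κ : Space d → ℝ}

/-- The local inverse operator `𝓛⁻¹ : L²(ω) → H¹₀(ω)`, `𝓛 = -∇·(κ∇)`, obtained from the
Lax–Milgram theorem: `𝓛⁻¹ f` is the unique `u ∈ H¹₀(ω)` with `a(u, v) = ∫_ω f v` for all
`v ∈ H¹₀(ω)`; see `energy_inverseOp` and `eq_inverseOp`. -/
def inverseOp (hω : Bornology.IsBounded ω) (hκ : IsPermeability ω κ) : L2 ω →L[ℝ] H10 ω :=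
  ((energyForm_isCoercive hω hκ).continuousLinearEquivOfBilin.symm : H10 ω →L[ℝ] H10 ω).comp
    (ContinuousLinearMap.adjoint (toL2 ω))

theorem energy_inverseOp (hω : Bornology.IsBounded ω) (hκ : IsPermeability ω κ) (f : L2 ω)
    (v : H10 ω) : energy ω κ (inverseOp hω hκ f) v = ∫ x in ω, f x * toL2 ω v x := by
  rw [← energyForm_apply hκ,
    ← (energyForm_isCoercive hω hκ).continuousLinearEquivOfBilin_apply]
  simp only [inverseOp, ContinuousLinearMap.comp_apply, ContinuousLinearEquiv.coe_coe,
    ContinuousLinearEquiv.apply_symm_apply, ContinuousLinearMap.adjoint_inner_left]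
  rw [L2.inner_def]
  simp [mul_comm]

theorem eq_inverseOp (hω : Bornology.IsBounded ω) (hκ : IsPermeability ω κ) (f : L2 ω)
    (u : H10 ω) (hu : ∀ v : H10 ω, energy ω κ u v = ∫ x in ω, f x * toL2 ω v x) :
    u = inverseOp hω hκ f := by
  have hE := energyForm_isCoercive hω hκ
  refine hE.continuousLinearEquivOfBilin.injective (ext_inner_right ℝ fun w => ?_)
  rw [hE.continuousLinearEquivOfBilin_apply, hE.continuousLinearEquivOfBilin_apply,
    energyForm_apply, energyForm_apply, hu, energy_inverseOp]

/-- The local inverse operator `𝓛⁻¹` acting on `H¹₀(ω) ⊆ L²(ω)`. -/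
def localInverse (hω : Bornology.IsBounded ω) (hκ : IsPermeability ω κ) :
    H10 ω →L[ℝ] H10 ω :=
  (inverseOp hω hκ).comp (toL2 ω)

/-- `(lam j, φ j)`, `j = 1, 2, 3, …`, are all the eigenpairs of `𝓛⁻¹` on `H¹₀(ω)`, the
eigenvalues being listed in decreasing order and repeated according to multiplicity, with
`a`-orthogonal eigenfunctions: the `φ j` with `lam j = μ` span the eigenspace of every `μ`. -/
def IsEigenpairs (hω : Bornology.IsBounded ω) (hκ : IsPermeability ω κ)
    (lam : ℕ+ → ℝ) (φ : ℕ+ → H10 ω) : Prop :=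
  Antitone lam ∧
  (∀ j, φ j ≠ 0 ∧ localInverse hω hκ (φ j) = lam j • φ j) ∧
  (∀ m n, m ≠ n → energy ω κ (φ m) (φ n) = 0) ∧
  ∀ (μ : ℝ) (u : H10 ω), localInverse hω hκ u = μ • u →
    u ∈ Submodule.span ℝ (φ '' {j | lam j = μ})

/-- The Krylov space `𝓚_k(𝓛⁻¹, ψ) = span {ψ, 𝓛⁻¹ψ, …, 𝓛^{-(k-1)}ψ}`. -/
def krylov (hω : Bornology.IsBounded ω) (hκ : IsPermeability ω κ) (k : ℕ) (ψ : H10 ω) :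
    Submodule ℝ (H10 ω) :=
  Submodule.span ℝ {u | ∃ s < k, u = (localInverse hω hκ ^ s) ψ}

end Operator

/-- The relative spectral gap `γʲ = (λʲ - λʲ⁺¹) / λʲ⁺¹`. -/
def relGap (lam : ℕ+ → ℝ) (j : ℕ+) : ℝ := (lam j - lam (j + 1)) / lam (j + 1)

end LKSI

end

section

open MeasureTheory Polynomial
open scoped Gradient InnerProductSpace

namespace LKSI

/-! ### Translation and mollification estimates in `L²` -/

section Translation

variable {E : Type*} [NormedAddCommGroup E] [NormedSpace ℝ E]

/-! Elements of the Krylov space are `q(𝓛⁻¹)ψ` with `deg q < k`, and `q(𝓛⁻¹)` acts on `φ m` as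
multiplication by `q (lam m)`. Let `c` be the coefficient of `ψ` along `φ j`. If `q (lam j) = 1` and
`|q (lam m)| ≤ M` for `m ≠ j`, then `a`-orthogonality and completeness of the eigenfunctions give
`‖q(𝓛⁻¹)ψ - c φ j‖_a ≤ M ‖ψ‖_a` (`energy_aeval_sub_le`); dividing by `c` gives the approximation of
`φ j`.

A suitable `q` is built in `exists_filter_polynomial`: a product vanishing at `lam m` for `m < j`,
times a Chebyshev polynomial of degree `k - j` transplanted from `[-1, 1]` to `[0, lam (j + 1)]`,
which contains all later eigenvalues, normalised at `lam j`. At `lam j` the Chebyshev argument is `1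
+ 2γ = (1 + r) / 2` with `r = 1 + 4γ`, where `T_n` is at least `r ^ n / 2`
(`pow_div_two_le_eval_T`).

Completeness is deduced from the spectral theorem for the compact self-adjoint operator that `𝓛⁻¹`
induces on `L²(ω)`. Its compactness is Rellich's theorem (`isCompactOperator_toL2`): up to a small
multiple of the gradient norm, the `L²` norm is controlled by finitely many local averages. -/

theorem sq_intervalIntegral_le {g : ℝ → ℝ} (hg : Continuous g) :
    (∫ t in (0 : ℝ)..1, g t) ^ 2 ≤ ∫ t in (0 : ℝ)..1, g t ^ 2 := by
  set m := ∫ t in (0 : ℝ)..1, g t with hm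
  -- The inequality is the nonnegativity of the variance of `g`.
  have h0 : 0 ≤ ∫ t in (0 : ℝ)..1, (g t - m) ^ 2 :=
    intervalIntegral.integral_nonneg zero_le_one fun t _ => sq_nonneg _
  have h1 : ∫ t in (0 : ℝ)..1, (g t - m) ^ 2 =
      (∫ t in (0 : ℝ)..1, g t ^ 2) - 2 * m * m + m ^ 2 := by
    have : ∀ t, (g t - m) ^ 2 = g t ^ 2 - 2 * m * g t + m ^ 2 := fun t => by ring
    simp only [this]
    rw [intervalIntegral.integral_add, intervalIntegral.integral_sub,
      intervalIntegral.integral_const_mul, ← hm]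
    · simp
    all_goals exact Continuous.intervalIntegrable (by fun_prop) _ _
  nlinarith

theorem sq_sub_le_intervalIntegral {f : E → ℝ} (hf : ContDiff ℝ 1 f) (x z : E) :
    (f (x + z) - f x) ^ 2 ≤ ‖z‖ ^ 2 * ∫ t in (0 : ℝ)..1, ‖fderiv ℝ f (x + t • z)‖ ^ 2 := by
  have hcd : Continuous (fderiv ℝ f) := hf.continuous_fderiv one_ne_zero
  have hline : Continuous fun t : ℝ => x + t • z := by fun_prop
  have hc : Continuous fun t : ℝ => fderiv ℝ f (x + t • z) z :=
    (hcd.comp hline).clm_apply continuous_const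
  have hderiv : ∀ t : ℝ, HasDerivAt (fun s : ℝ => f (x + s • z)) (fderiv ℝ f (x + t • z) z) t := by
    intro t
    have h1 : HasDerivAt (fun s : ℝ => x + s • z) z t := by
      simpa using ((hasDerivAt_id t).smul_const z).const_add x
    exact ((hf.differentiable one_ne_zero) _).hasFDerivAt.comp_hasDerivAt t h1
  have h2 : ∫ t in (0 : ℝ)..1, fderiv ℝ f (x + t • z) z = f (x + z) - f x := by
    rw [intervalIntegral.integral_eq_sub_of_hasDerivAt (fun t _ => hderiv t)
      (hc.intervalIntegrable _ _)]
    simp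
  rw [← h2, ← intervalIntegral.integral_const_mul]
  refine (sq_intervalIntegral_le hc).trans (intervalIntegral.integral_mono zero_le_one
    ((hc.pow 2).intervalIntegrable _ _)
    ((((hcd.comp hline).norm.pow 2).const_mul _).intervalIntegrable _ _) fun t => ?_)
  have := (fderiv ℝ f (x + t • z)).le_opNorm z
  calc (fderiv ℝ f (x + t • z) z) ^ 2 = ‖fderiv ℝ f (x + t • z) z‖ ^ 2 := by simp
    _ ≤ (‖fderiv ℝ f (x + t • z)‖ * ‖z‖) ^ 2 := by gcongr
    _ = ‖z‖ ^ 2 * ‖fderiv ℝ f (x + t • z)‖ ^ 2 := by ring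

variable [FiniteDimensional ℝ E]
  [MeasurableSpace E] [BorelSpace E] {μ : Measure E} [μ.IsAddHaarMeasure]

/-- Translation estimate: `‖f(· + z) - f‖_{L²} ≤ ‖z‖ ‖∇f‖_{L²}`. -/
theorem integral_sq_translate_sub_le {f : E → ℝ} (hf : ContDiff ℝ 1 f)
    (hfc : HasCompactSupport f) (z : E) :
    ∫ x, (f (x + z) - f x) ^ 2 ∂μ ≤ ‖z‖ ^ 2 * ∫ x, ‖fderiv ℝ f x‖ ^ 2 ∂μ := by
  have hcd : Continuous (fderiv ℝ f) := hf.continuous_fderiv one_ne_zero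
  have hi : Integrable (fun x => ‖fderiv ℝ f x‖ ^ 2) μ :=
    (hcd.norm.pow 2).integrable_of_hasCompactSupport
      ((hfc.fderiv ℝ).mono fun x hx h => hx (by simp [h]))
  have hprod : Integrable (Function.uncurry fun (x : E) (t : ℝ) => ‖fderiv ℝ f (x + t • z)‖ ^ 2)
      (μ.prod (volume.restrict (Set.Ioc (0 : ℝ) 1))) := by
    have hc : Continuous (Function.uncurry fun (x : E) (t : ℝ) => ‖fderiv ℝ f (x + t • z)‖ ^ 2) := by
      simp only [Function.uncurry_def]
      exact ((hcd.comp (by fun_prop)).norm.pow 2)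
    rw [integrable_prod_iff' hc.aestronglyMeasurable]
    refine ⟨Filter.Eventually.of_forall fun t => hi.comp_add_right (t • z), ?_⟩
    have : ∀ t : ℝ, ∫ x, ‖‖fderiv ℝ f (x + t • z)‖ ^ 2‖ ∂μ = ∫ x, ‖‖fderiv ℝ f x‖ ^ 2‖ ∂μ :=
      fun t => integral_add_right_eq_self (fun x => ‖‖fderiv ℝ f x‖ ^ 2‖) (t • z)
    simp only [Function.uncurry_apply_pair, this]
    exact integrable_const _
  -- After Fubini, translation invariance makes the inner integral independent of `t`.
  have hswap : ∫ x, (∫ t in (0 : ℝ)..1, ‖fderiv ℝ f (x + t • z)‖ ^ 2) ∂μ =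
      ∫ x, ‖fderiv ℝ f x‖ ^ 2 ∂μ := by
    simp only [intervalIntegral.integral_of_le zero_le_one]
    rw [integral_integral_swap hprod]
    have : ∀ t : ℝ, ∫ x, ‖fderiv ℝ f (x + t • z)‖ ^ 2 ∂μ = ∫ x, ‖fderiv ℝ f x‖ ^ 2 ∂μ :=
      fun t => integral_add_right_eq_self (fun x => ‖fderiv ℝ f x‖ ^ 2) (t • z)
    simp [this]
  rw [← hswap, ← integral_const_mul]
  refine integral_mono_of_nonneg (Filter.Eventually.of_forall fun x => sq_nonneg _) ?_
    (Filter.Eventually.of_forall fun x => sq_sub_le_intervalIntegral hf x z)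
  refine Integrable.const_mul ?_ _
  simp only [intervalIntegral.integral_of_le zero_le_one]
  exact hprod.integral_prod_left

/-- Expanding the square and using translation invariance, `∫ f² - ∫ f f(· + z)` is half of `∫ (f(·
+ z) - f)²`; the factor one half is given away. -/
theorem integral_sq_le_add_integral_mul_translate {f : E → ℝ} (hf : ContDiff ℝ 1 f)
    (hfc : HasCompactSupport f) (z : E) :
    ∫ x, f x ^ 2 ∂μ ≤ ∫ x, f x * f (x + z) ∂μ + ‖z‖ ^ 2 * ∫ x, ‖fderiv ℝ f x‖ ^ 2 ∂μ := by
  have hcf := hf.continuous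
  have hi : Integrable (fun x => f x ^ 2) μ :=
    (hcf.pow 2).integrable_of_hasCompactSupport (hfc.mono fun x hx h => hx (by simp [h]))
  have hi' : Integrable (fun x => f (x + z) ^ 2) μ := hi.comp_add_right z
  have hi2 : Integrable (fun x => f x * f (x + z)) μ :=
    (hcf.mul (by fun_prop)).integrable_of_hasCompactSupport
      (hfc.mono fun x hx h => hx (by simp [h]))
  have h1 : ∫ x, (f (x + z) - f x) ^ 2 ∂μ =
      2 * ∫ x, f x ^ 2 ∂μ - 2 * ∫ x, f x * f (x + z) ∂μ := by
    have : ∀ x, (f (x + z) - f x) ^ 2 = f (x + z) ^ 2 + f x ^ 2 - 2 * (f x * f (x + z)) :=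
      fun x => by ring
    simp only [this]
    rw [integral_sub (by exact hi'.add hi) (hi2.const_mul 2), integral_add hi' hi, integral_const_mul,
      integral_add_right_eq_self (fun x => f x ^ 2) z]
    ring
  have h2 := integral_sq_translate_sub_le (μ := μ) hf hfc z
  have h3 : 0 ≤ ∫ x, (f (x + z) - f x) ^ 2 ∂μ := integral_nonneg fun x => sq_nonneg _
  linarith

/-- Approximation of `f` by its mollification with a kernel `ρ` of radius `h`, in weak form. -/
theorem integral_sq_le_add_integral_mollify {f ρ : E → ℝ} (hf : ContDiff ℝ 1 f)
    (hfc : HasCompactSupport f) (hρ : Continuous ρ) (hρc : HasCompactSupport ρ)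
    (hρ0 : ∀ z, 0 ≤ ρ z) (hρ1 : ∫ z, ρ z ∂μ = 1) {h : ℝ} (hh : ∀ z, ρ z ≠ 0 → ‖z‖ ≤ h) :
    ∫ x, f x ^ 2 ∂μ ≤
      ∫ x, f x * (∫ y, f y * ρ (y - x) ∂μ) ∂μ + h ^ 2 * ∫ x, ‖fderiv ℝ f x‖ ^ 2 ∂μ := by
  have hcf := hf.continuous
  set A := ∫ x, f x ^ 2 ∂μ
  set D := ∫ x, ‖fderiv ℝ f x‖ ^ 2 ∂μ with hD
  have hD0 : 0 ≤ D := integral_nonneg fun x => by positivity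
  have hprod : Integrable (Function.uncurry fun x z => ρ z * (f x * f (x + z))) (μ.prod μ) := by
    refine Continuous.integrable_of_hasCompactSupport ?_ ?_
    · simp only [Function.uncurry_def]
      fun_prop
    · refine HasCompactSupport.intro (hfc.prod hρc) fun p hp => ?_
      simp only [Set.mem_prod, not_and_or] at hp
      rcases hp with hp | hp
      · simp [Function.uncurry_def, image_eq_zero_of_notMem_tsupport hp]
      · simp [Function.uncurry_def, image_eq_zero_of_notMem_tsupport hp]
  have hρi : Integrable ρ μ := hρ.integrable_of_hasCompactSupport hρc
  have hpt : ∀ z, ρ z * A ≤ (∫ x, ρ z * (f x * f (x + z)) ∂μ) + ρ z * (h ^ 2 * D) := by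
    -- The translate estimate is averaged against the weight `ρ z`, whose support restricts it to
    -- `‖z‖ ≤ h`.
    intro z
    by_cases hz : ρ z = 0
    · simp [hz]
    · have h1 := integral_sq_le_add_integral_mul_translate (μ := μ) hf hfc z
      have h2 : ‖z‖ ^ 2 * D ≤ h ^ 2 * D := by gcongr; exact hh z hz
      rw [integral_const_mul, ← mul_add]
      exact mul_le_mul_of_nonneg_left (h1.trans (by linarith)) (hρ0 z)
  have hmono := integral_mono (hρi.mul_const A) (hprod.integral_prod_right.add
    (hρi.mul_const (h ^ 2 * D))) hpt
  simp only [Pi.add_apply] at hmono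
  rw [integral_add hprod.integral_prod_right (hρi.mul_const (h ^ 2 * D)),
    integral_mul_const, integral_mul_const, hρ1, one_mul, one_mul] at hmono
  simp only [Function.uncurry_apply_pair] at hmono
  rw [← integral_integral_swap hprod] at hmono
  have hconv : ∀ x, f x * ∫ y, f y * ρ (y - x) ∂μ = ∫ z, ρ z * (f x * f (x + z)) ∂μ := by
    intro x
    rw [← integral_const_mul, ← integral_add_right_eq_self _ x]
    congr 1
    ext z
    rw [add_sub_cancel_right, add_comm z x]
    ring
  simpa only [hconv] using hmono

end Translation

/-! ### Compactness of the embedding of `H¹₀(ω)` into `L²(ω)` -/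

section Rellich

variable {d : ℕ} {ω : Set (Space d)}

/-- A bound on a test function by its gradient and finitely many linear functionals. -/
theorem exists_finite_testFunction_bound (hω : Bornology.IsBounded ω) {h η : ℝ}
    (hh : 0 < h) (hη : 0 < η) :
    ∃ (s : Finset (Space d)) (ρ : Space d → ℝ), Continuous ρ ∧ HasCompactSupport ρ ∧
      ∀ f : Space d → ℝ, IsTestFunction ω f →
        ∫ x in ω, f x ^ 2 ≤ h ^ 2 * (∫ x in ω, ‖∇ f x‖ ^ 2) +
          (∑ p ∈ s, |∫ y in ω, f y * ρ (y - p)|) * (∫ x in ω, |f x|) +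
          η * (∫ x in ω, |f x|) ^ 2 := by
  let b : ContDiffBump (0 : Space d) := ⟨h / 2, h, by positivity, by linarith⟩
  let ρ : Space d → ℝ := b.normed volume
  have hρ : Continuous ρ := b.continuous_normed
  have hρc : HasCompactSupport ρ := b.hasCompactSupport_normed
  have hρh : ∀ z, ρ z ≠ 0 → ‖z‖ ≤ h := by
    intro z hz
    have : z ∈ Function.support ρ := hz
    rw [b.support_normed_eq] at this
    simpa using (Metric.mem_ball.1 this).le
  obtain ⟨δ, hδ, hρδ⟩ := Metric.uniformContinuous_iff.1
    (hρc.uniformContinuous_of_continuous hρ) η hη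
  -- A finite `δ`-net of `ω`. Moving `x` to a net point changes the kernel `ρ (y - x)` by less than
  -- `η`, hence the mollification of `f` by at most `η` times the `L¹` norm of `f`.
  obtain ⟨t, -, htf, htc⟩ := Metric.finite_approx_of_totallyBounded 
    (hω.isCompact_closure.totallyBounded.subset subset_closure) δ hδ
  refine ⟨htf.toFinset, ρ, hρ, hρc, fun f hf => ?_⟩
  have hf0 : ∀ x, x ∉ ω → f x = 0 := fun x hx =>
    image_eq_zero_of_notMem_tsupport (fun h => hx (hf.tsupport_subset h))
  have hg0 : ∀ x, x ∉ ω → fderiv ℝ f x = 0 := fun x hx => by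
    by_contra h
    exact hx (hf.tsupport_subset (support_fderiv_subset ℝ (Function.mem_support.2 h)))
  have hgn : ∀ x, ‖∇ f x‖ = ‖fderiv ℝ f x‖ := fun x => by simp [gradient]
  simp only [hgn]
  rw [setIntegral_eq_integral_of_forall_compl_eq_zero
      (fun x hx => by rw [hf0 x hx]; norm_num),
    setIntegral_eq_integral_of_forall_compl_eq_zero (f := fun x => ‖fderiv ℝ f x‖ ^ 2)
      (fun x hx => by rw [hg0 x hx]; simp),
    setIntegral_eq_integral_of_forall_compl_eq_zero (f := fun x => |f x|)
      (fun x hx => by rw [hf0 x hx]; simp)]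
  have hset : ∀ p, ∫ y in ω, f y * ρ (y - p) = ∫ y, f y * ρ (y - p) := fun p =>
    setIntegral_eq_integral_of_forall_compl_eq_zero (fun x hx => by rw [hf0 x hx]; simp)
  simp only [hset]
  set S := ∑ p ∈ htf.toFinset, |∫ y, f y * ρ (y - p)| with hS
  have hcf : Continuous f := hf.smooth.continuous
  have hfi : Integrable (fun x => |f x|) (volume : Measure (Space d)) :=
    hcf.abs.integrable_of_hasCompactSupport
      (hf.hasCompactSupport.mono fun x hx h => hx (by simp [h]))
  have hfρ : ∀ p, Integrable (fun y => f y * ρ (y - p)) (volume : Measure (Space d)) := fun p =>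
    (hcf.mul (by fun_prop)).integrable_of_hasCompactSupport
      (hf.hasCompactSupport.mono fun x hx h => hx (by simp [h]))
  set N := ∫ x, |f x| with hN
  have hpt : ∀ x ∈ ω, |∫ y, f y * ρ (y - x)| ≤ S + η * N := by
    intro x hx
    obtain ⟨p, hp, hxp⟩ := Set.mem_iUnion₂.1 (htc hx)
    have h1 : |∫ y, f y * ρ (y - p)| ≤ S :=
      Finset.single_le_sum (f := fun p => |∫ y, f y * ρ (y - p)|) (fun _ _ => abs_nonneg _)
        (htf.mem_toFinset.2 hp)
    have h2 : |(∫ y, f y * ρ (y - x)) - ∫ y, f y * ρ (y - p)| ≤ η * N := by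
      rw [← integral_sub (hfρ x) (hfρ p), hN, ← integral_const_mul, ← Real.norm_eq_abs]
      refine norm_integral_le_of_norm_le (hfi.const_mul η) (Filter.Eventually.of_forall fun y => ?_)
      have h3 : dist (ρ (y - x)) (ρ (y - p)) < η := hρδ (by
        rw [dist_sub_left]; exact hxp)
      rw [← mul_sub, norm_mul, Real.norm_eq_abs, mul_comm]
      exact mul_le_mul_of_nonneg_right h3.le (abs_nonneg _)
    have h4 := abs_sub_abs_le_abs_sub (∫ y, f y * ρ (y - x)) (∫ y, f y * ρ (y - p))
    linarith
  have h5 : ∫ x, f x * (∫ y, f y * ρ (y - x)) ≤ N * (S + η * N) := by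
    rw [hN, ← integral_mul_const]
    refine (le_abs_self _).trans ?_
    rw [← Real.norm_eq_abs]
    refine norm_integral_le_of_norm_le (hfi.mul_const _) (Filter.Eventually.of_forall fun x => ?_)
    rw [norm_mul, Real.norm_eq_abs, Real.norm_eq_abs]
    by_cases hx : x ∈ ω
    · exact mul_le_mul_of_nonneg_left (hpt x hx) (abs_nonneg _)
    · simp [hf0 x hx]
  have h6 := integral_sq_le_add_integral_mollify (μ := (volume : Measure (Space d)))
    (hf.smooth.of_le (by simp)) hf.hasCompactSupport hρ hρc b.nonneg_normed
    (b.integral_normed) hρh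
  linarith [h6, h5]

theorem sq_integral_abs_le {α : Type*} [MeasurableSpace α] {ν : Measure α} [IsFiniteMeasure ν]
    {f : α → ℝ} (hf : MemLp f 2 ν) :
    (∫ x, |f x| ∂ν) ^ 2 ≤ (ν.real Set.univ + 1) * ∫ x, f x ^ 2 ∂ν := by
  set N := ∫ x, |f x| ∂ν with hN
  -- The added `1` keeps `c` positive when the measure vanishes; expanding `∫ (c|f| - N)² ≥ 0` then
  -- gives the Cauchy–Schwarz bound.
  set c := ν.real Set.univ + 1 with hc
  have hc0 : 0 < c := by positivity
  have h1 : Integrable (fun x => |f x|) ν := (hf.integrable one_le_two).abs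
  have h2 : Integrable (fun x => f x ^ 2) ν := hf.integrable_sq
  have h0 : 0 ≤ ∫ x, (c * |f x| - N) ^ 2 ∂ν := integral_nonneg fun x => sq_nonneg _
  have h3 : ∫ x, (c * |f x| - N) ^ 2 ∂ν =
      c ^ 2 * ∫ x, f x ^ 2 ∂ν - 2 * c * N * N + ν.real Set.univ * N ^ 2 := by
    have : ∀ x, (c * |f x| - N) ^ 2 = c ^ 2 * f x ^ 2 - 2 * c * N * |f x| + N ^ 2 := fun x => by
      rw [← sq_abs (f x)]; ring
    simp only [this]
    rw [integral_add (by exact (h2.const_mul _).sub (h1.const_mul _)) (integrable_const _),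
      integral_sub (h2.const_mul _) (h1.const_mul _), integral_const_mul, integral_const_mul,
      integral_const, smul_eq_mul]
  have h4 : c * N ^ 2 ≤ c * (c * ∫ x, f x ^ 2 ∂ν) := by
    have : 0 ≤ N ^ 2 := sq_nonneg N
    nlinarith
  exact le_of_mul_le_mul_left h4 hc0

/-- A quantitative form of the compactness of the embedding of `H¹₀(ω)` into `L²(ω)`. -/
theorem exists_finite_norm_bound (hω : Bornology.IsBounded ω) {ε : ℝ} (hε : 0 < ε) :
    ∃ (s : Finset (Space d)) (g : Space d → L2 ω) (c : ℝ), ∀ u : H10 ω,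
      ‖toL2 ω u‖ ^ 2 ≤ ε ^ 2 * ‖grad ω u‖ ^ 2 + c * (∑ p ∈ s, |⟪g p, toL2 ω u⟫_ℝ|) * ‖toL2 ω u‖ := by
  have : IsFiniteMeasure ((volume : Measure (Space d)).restrict ω) :=
    isFiniteMeasure_restrict.2 hω.measure_lt_top.ne
  set V := ((volume : Measure (Space d)).restrict ω).real Set.univ + 1 with hV
  have hV0 : 0 < V := by positivity
  -- With `η = 1 / (2V)`, the term `η (∫ |f|)²` is at most half of `‖f‖²` and is absorbed on the
  -- left. This doubles the other terms, which `h = ε / 2` and the factor `2 * √V` allow for.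
  obtain ⟨s, ρ, hρ, hρc, hb⟩ := exists_finite_testFunction_bound hω (half_pos hε)
    (show 0 < 1 / (2 * V) by positivity)
  obtain ⟨M, hM⟩ := hρc.exists_bound_of_continuous hρ
  have hmem : ∀ p, MemLp (fun y => ρ (y - p)) 2 ((volume : Measure (Space d)).restrict ω) := fun p =>
    MemLp.of_bound (by fun_prop) M (Filter.Eventually.of_forall fun y => hM _)
  refine ⟨s, fun p => (hmem p).toLp, 2 * √V, fun u => ?_⟩
  have hfc := (WithLp.fstL 2 ℝ (L2 ω) (L2Vec ω)).continuous
  have hsc := (WithLp.sndL 2 ℝ (L2 ω) (L2Vec ω)).continuous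
  have hcl : IsClosed {q : L2Pair ω | ‖q.fst‖ ^ 2 ≤ ε ^ 2 * ‖q.snd‖ ^ 2 +
      2 * √V * (∑ p ∈ s, |⟪(hmem p).toLp, q.fst⟫_ℝ|) * ‖q.fst‖} := by
    refine isClosed_le (hfc.norm.pow 2) ((continuous_const.mul (hsc.norm.pow 2)).add ?_)
    exact (continuous_const.mul (continuous_finsetSum _ fun p _ =>
      (continuous_const.inner hfc).abs)).mul hfc.norm
  -- Both sides are continuous in the `H¹` norm, so test functions suffice.
  refine closure_minimal ?_ hcl u.2
  rintro q ⟨f, hf, h1, h2⟩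
  have e1 : ‖q.fst‖ ^ 2 = ∫ x in ω, f x ^ 2 := by
    rw [norm_sq_eq_integral]
    refine integral_congr_ae ?_
    filter_upwards [h1] with x hx
    rw [hx, Real.norm_eq_abs, sq_abs]
  have e2 : ‖q.snd‖ ^ 2 = ∫ x in ω, ‖∇ f x‖ ^ 2 := by
    rw [norm_sq_eq_integral]
    refine integral_congr_ae ?_
    filter_upwards [h2] with x hx
    rw [hx]
  have e3 : ∀ p, ⟪(hmem p).toLp, q.fst⟫_ℝ = ∫ y in ω, f y * ρ (y - p) := fun p => by
    rw [L2.inner_def]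
    refine integral_congr_ae ?_
    filter_upwards [h1, (hmem p).coeFn_toLp] with x hx hx'
    rw [hx, hx']
    rfl
  have hfm : MemLp f 2 ((volume : Measure (Space d)).restrict ω) :=
    (memLp_congr_ae h1).1 (Lp.memLp q.fst)
  have h3 := sq_integral_abs_le hfm
  have h4 := hb f hf
  simp only [← e3] at h4
  rw [← e1, ← e2] at h4
  rw [← e1, ← hV] at h3
  have hS : 0 ≤ ∑ p ∈ s, |⟪(hmem p).toLp, q.fst⟫_ℝ| := Finset.sum_nonneg fun _ _ => abs_nonneg _
  have h5 : ∫ x in ω, |f x| ≤ √V * ‖q.fst‖ := by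
    refine le_of_sq_le_sq ?_ (by positivity)
    rw [mul_pow, Real.sq_sqrt hV0.le]
    exact h3
  have h6 : 1 / (2 * V) * (∫ x in ω, |f x|) ^ 2 ≤ ‖q.fst‖ ^ 2 / 2 := by
    rw [div_mul_eq_mul_div, div_le_iff₀ (by positivity)]
    linarith
  have h7 := mul_le_mul_of_nonneg_left h5 hS
  show ‖q.fst‖ ^ 2 ≤ ε ^ 2 * ‖q.snd‖ ^ 2 +
      2 * √V * (∑ p ∈ s, |⟪(hmem p).toLp, q.fst⟫_ℝ|) * ‖q.fst‖
  nlinarith [sq_nonneg (ε * ‖q.snd‖)]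

/-- Composing `T` with the orthogonal projection onto `F` gives a finite-rank operator within `ε` of
`T`, and compact operators are closed in operator norm. -/
theorem isCompactOperator_of_forall_norm_le {H G : Type*} [NormedAddCommGroup H]
    [InnerProductSpace ℝ H] [NormedAddCommGroup G] [NormedSpace ℝ G] [CompleteSpace G]
    (T : H →L[ℝ] G) (hT : ∀ ε : ℝ, 0 < ε → ∃ F : Submodule ℝ H, FiniteDimensional ℝ F ∧
      ∀ w ∈ Fᗮ, ‖T w‖ ≤ ε * ‖w‖) : IsCompactOperator T := by
  refine isClosed_setOfPred_isCompactOperator.closure_subset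
    ((Metric.mem_closure_iff (α := H →L[ℝ] G)).2 fun ε hε => ?_)
  obtain ⟨F, hF, hb⟩ := hT (ε / 2) (half_pos hε)
  have := FiniteDimensional.proper ℝ F
  refine ⟨(T.comp F.subtypeL).comp F.orthogonalProjectionOnto,
    (isCompactOperator_of_locallyCompactSpace_dom F.orthogonalProjectionOnto).clm_comp
      (T.comp F.subtypeL), ?_⟩
  refine (dist_eq_norm (E := H →L[ℝ] G) _ _).trans_lt ?_
  refine lt_of_le_of_lt (ContinuousLinearMap.opNorm_le_bound _ (half_pos hε).le fun u => ?_)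
    (half_lt_self hε)
  set v : H := ((F.orthogonalProjectionOnto u : F) : H) with hv
  have hwF : u - v ∈ Fᗮ := F.sub_starProjection_mem_orthogonal u
  have h1 : ‖u - v‖ ≤ ‖u‖ := by
    have h := norm_add_sq_real v (u - v)
    rw [hwF _ (F.orthogonalProjectionOnto u).2, add_sub_cancel] at h
    refine le_of_sq_le_sq ?_ (norm_nonneg _)
    nlinarith [sq_nonneg ‖v‖]
  have h2 : (T - (T.comp F.subtypeL).comp F.orthogonalProjectionOnto) u = T (u - v) := by
    simp [hv]
  rw [h2]
  exact (hb _ hwF).trans (by gcongr)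

/-- The **Rellich–Kondrachov theorem** for `H¹₀(ω)`. -/
theorem isCompactOperator_toL2 (hω : Bornology.IsBounded ω) : IsCompactOperator (toL2 ω) := by
  refine isCompactOperator_of_forall_norm_le (toL2 ω) fun ε hε => ?_
  obtain ⟨s, g, c, hb⟩ := exists_finite_norm_bound hω hε
  -- Orthogonality to the adjoint images of the `g p` annihilates every functional in the bound,
  -- leaving only the gradient term.
  refine ⟨Submodule.span ℝ ((fun p => ContinuousLinearMap.adjoint (toL2 ω) (g p)) '' s),
    FiniteDimensional.span_of_finite ℝ (s.finite_toSet.image _), fun w hw => ?_⟩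
  have h0 : ∀ p ∈ s, |⟪g p, toL2 ω w⟫_ℝ| = 0 := fun p hp => by
    rw [← ContinuousLinearMap.adjoint_inner_left, abs_eq_zero]
    exact hw _ (Submodule.subset_span ⟨p, hp, rfl⟩)
  have h2 := hb w
  rw [Finset.sum_eq_zero h0, mul_zero, zero_mul, add_zero] at h2
  refine le_of_sq_le_sq (h2.trans ?_) (by positivity)
  rw [mul_pow]
  have := norm_grad_le w
  gcongr

end Rellich

/-! ### Growth of Chebyshev polynomials -/

/-- At `(1 + r) / 2` the recurrence reads `T_{n+2} = (1 + r) T_{n+1} - T_n`, so `T_{n+2} - r T_{n+1}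
= T_{n+1} - T_n`, and a ratio of at least `r ≥ 1` persists. The induction starts at `T_1`, since
`T_1 / T_0 = (1 + r) / 2` may be less than `r`; this is where the factor one half in the final bound
comes from. -/
theorem mul_eval_T_le {r : ℝ} (hr : 1 ≤ r) (n : ℕ) :
    r * (Chebyshev.T ℝ (n + 1 : ℕ)).eval ((1 + r) / 2) ≤
      (Chebyshev.T ℝ (n + 2 : ℕ)).eval ((1 + r) / 2) ∧
    0 < (Chebyshev.T ℝ (n + 1 : ℕ)).eval ((1 + r) / 2) := by
  induction n with
  | zero =>
    constructor
    · simp [Chebyshev.T_two]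
      nlinarith
    · simp
      linarith
  | succ n ih =>
    obtain ⟨h1, h2⟩ := ih
    have h3 : (Chebyshev.T ℝ (n + 1 + 2 : ℕ)).eval ((1 + r) / 2) =
        (1 + r) * (Chebyshev.T ℝ (n + 2 : ℕ)).eval ((1 + r) / 2) -
          (Chebyshev.T ℝ (n + 1 : ℕ)).eval ((1 + r) / 2) := by
      have := Chebyshev.T_add_two ℝ (n + 1 : ℤ)
      push_cast
      rw [this]
      simp only [eval_sub, eval_mul, eval_X, eval_ofNat]
      rw [show (n + 1 + 1 : ℤ) = n + 2 by ring]
      ring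
    have h4 : 0 < (Chebyshev.T ℝ (n + 2 : ℕ)).eval ((1 + r) / 2) := by nlinarith
    refine ⟨?_, h4⟩
    rw [h3, show n + 1 + 1 = n + 2 by ring]
    nlinarith

/-- Growth of the Chebyshev polynomials to the right of `1`. -/
theorem pow_div_two_le_eval_T {r : ℝ} (hr : 1 ≤ r) (n : ℕ) :
    r ^ n / 2 ≤ (Chebyshev.T ℝ n).eval ((1 + r) / 2) := by
  rcases n with _ | n
  · simp; norm_num
  induction n with
  | zero => simp; linarith
  | succ n ih =>
    refine le_trans ?_ (mul_eval_T_le hr n).1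
    rw [pow_succ']
    nlinarith

/-! ### Completeness of the eigenfunctions and the spectral estimate -/

section Completeness

variable {d : ℕ} {ω : Set (Space d)} {κ : Space d → ℝ}

theorem energy_sum_self {ι : Type*} (hκ : IsPermeability ω κ) {φ : ι → H10 ω}
    (ho : ∀ m n, m ≠ n → energy ω κ (φ m) (φ n) = 0) (s : Finset ι) (c : ι → ℝ) :
    energy ω κ (∑ m ∈ s, c m • φ m) (∑ m ∈ s, c m • φ m) =
      ∑ m ∈ s, c m ^ 2 * energy ω κ (φ m) (φ m) := by
  simp only [← energyForm_apply hκ, map_sum, sum_apply, map_smul,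
    smul_apply, smul_eq_mul]
  refine Finset.sum_congr rfl fun m hm => ?_
  rw [Finset.sum_eq_single m]
  · ring
  · intro n _ hn
    rw [energyForm_apply, ho n m hn]; ring
  · exact fun h => absurd hm h

theorem aeval_apply_of_apply_eq_smul {H : Type*} [NormedAddCommGroup H] [NormedSpace ℝ H]
    {T : H →L[ℝ] H} {x : H} {μ : ℝ} (h : T x = μ • x) (q : ℝ[X]) :
    aeval T q x = q.eval μ • x := by
  have hpow : ∀ n : ℕ, (T ^ n) x = μ ^ n • x := fun n => by
    induction n with
    | zero => simp
    | succ n ih => rw [pow_succ, mul_apply_eq_comp, h, map_smul, ih, smul_smul, pow_succ']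
  rw [aeval_eq_sum_range, eval_eq_sum_range, sum_apply, Finset.sum_smul]
  refine Finset.sum_congr rfl fun i _ => ?_
  rw [smul_apply, hpow, smul_smul]

theorem energy_sum_eigenfunction {ι : Type*} (hκ : IsPermeability ω κ) {φ : ι → H10 ω}
    (ho : ∀ m n, m ≠ n → energy ω κ (φ m) (φ n) = 0) {s : Finset ι} {j : ι} (hj : j ∈ s)
    (c : ι → ℝ) : energy ω κ (∑ m ∈ s, c m • φ m) (φ j) = c j * energy ω κ (φ j) (φ j) := by
  rw [← energyForm_apply hκ, map_sum, sum_apply,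
    Finset.sum_eq_single j (fun m _ hm => ?_) (fun h => absurd hj h)]
  · rw [map_smul, smul_apply, energyForm_apply, smul_eq_mul]
  · rw [map_smul, smul_apply, energyForm_apply, ho m j hm, smul_zero]

/-- Density argument: writing the coefficient along `e` as `B v e / b` makes both sides continuous
in `v`, so the inequality passes from finite combinations to their closure. -/
theorem bilin_sub_smul_le_of_span {ι H : Type*} [NormedAddCommGroup H] [NormedSpace ℝ H]
    (B : H →L[ℝ] H →L[ℝ] ℝ) (A : H →L[ℝ] H) (e : H) (b M : ℝ) {φ : ι → H}
    (hφ : (Submodule.span ℝ (Set.range φ)).topologicalClosure = ⊤)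
    (h : ∀ c : ι →₀ ℝ,
      B (A (c.sum fun i a => a • φ i) - (B (c.sum fun i a => a • φ i) e / b) • e)
        (A (c.sum fun i a => a • φ i) - (B (c.sum fun i a => a • φ i) e / b) • e) ≤
      M * B (c.sum fun i a => a • φ i) (c.sum fun i a => a • φ i)) (v : H) :
    B (A v - (B v e / b) • e) (A v - (B v e / b) • e) ≤ M * B v v := by
  have hcl : IsClosed {v : H | B (A v - (B v e / b) • e) (A v - (B v e / b) • e) ≤ M * B v v} := by
    refine isClosed_le ?_ ?_ <;> fun_prop
  have hv : v ∈ (Submodule.span ℝ (Set.range φ)).topologicalClosure := hφ ▸ Submodule.mem_top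
  refine closure_minimal (fun v hv => ?_) hcl hv
  obtain ⟨c, rfl⟩ := (Finsupp.mem_span_range_iff_exists_finsupp (R := ℝ)).1 hv
  exact h c

variable [NeZero d]


theorem energy_inverseOp_eq_inner (hω : Bornology.IsBounded ω) (hκ : IsPermeability ω κ) (f : L2 ω)
    (v : H10 ω) : energy ω κ (inverseOp hω hκ f) v = ⟪f, toL2 ω v⟫_ℝ := by
  rw [energy_inverseOp, L2.inner_def]
  simp [mul_comm]

theorem eq_zero_of_energy_self (hω : Bornology.IsBounded ω) (hκ : IsPermeability ω κ) {u : H10 ω}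
    (h : energy ω κ u u = 0) : u = 0 := by
  obtain ⟨c, hc, hcoer⟩ := energyForm_isCoercive hω hκ
  have h1 := hcoer u
  rw [energyForm_apply, h] at h1
  by_contra hu
  have : 0 < c * ‖u‖ * ‖u‖ := by positivity
  linarith

theorem energy_self_nonneg (hω : Bornology.IsBounded ω) (hκ : IsPermeability ω κ) (u : H10 ω) :
    0 ≤ energy ω κ u u := by
  obtain ⟨c, hc, hcoer⟩ := energyForm_isCoercive hω hκ
  exact le_trans (by positivity) (hcoer u)

/-- The operator `T` induced on `L²(ω)` is compact and symmetric, and `inverseOp` carries its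
eigenvectors to eigenvectors of `localInverse`. Hence `toL2 ω u` is orthogonal to every eigenspace
of `T` and vanishes. -/
theorem eq_zero_of_energy_eigenpairs_eq_zero {hω : Bornology.IsBounded ω}
    {hκ : IsPermeability ω κ} {lam : ℕ+ → ℝ} {φ : ℕ+ → H10 ω} (hφ : IsEigenpairs hω hκ lam φ)
    {u : H10 ω} (hu : ∀ m, energy ω κ u (φ m) = 0) : u = 0 := by
  have hspan : ∀ (μ : ℝ) (v : H10 ω), localInverse hω hκ v = μ • v → energy ω κ u v = 0 := by
    intro μ v hv
    have hle : Submodule.span ℝ (φ '' {j | lam j = μ}) ≤ LinearMap.ker (energyForm hκ u).toLinearMap := by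
      rw [Submodule.span_le]
      rintro _ ⟨m, -, rfl⟩
      exact hu m
    exact hle (hφ.2.2.2 μ v hv)
  let T : L2 ω →L[ℝ] L2 ω := (toL2 ω).comp (inverseOp hω hκ)
  have hTc : IsCompactOperator T := (isCompactOperator_toL2 hω).comp_clm (inverseOp hω hκ)
  have hTe : ∀ f g, ⟪f, T g⟫_ℝ = energy ω κ (inverseOp hω hκ f) (inverseOp hω hκ g) :=
    fun f g => (energy_inverseOp_eq_inner hω hκ f _).symm
  have hTs : T.IsSymmetric := fun f g => by
    show ⟪T f, g⟫_ℝ = ⟪f, T g⟫_ℝ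
    rw [real_inner_comm, hTe, hTe, energy_comm]
  have h0 : toL2 ω u ∈ (⨆ μ, Module.End.eigenspace (T : Module.End ℝ (L2 ω)) μ)ᗮ := by
    rw [Submodule.mem_orthogonal]
    intro g hg
    suffices hle : (⨆ μ, Module.End.eigenspace (T : Module.End ℝ (L2 ω)) μ) ≤
        LinearMap.ker ((innerSL ℝ (toL2 ω u)).toLinearMap) by
      rw [real_inner_comm]
      exact hle hg
    refine iSup_le fun μ f hf => ?_
    have hf : T f = μ • f := Module.End.mem_eigenspace_iff.1 hf
    show ⟪toL2 ω u, f⟫_ℝ = 0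
    rw [real_inner_comm, ← energy_inverseOp_eq_inner hω hκ, energy_comm]
    refine hspan μ _ ?_
    show inverseOp hω hκ (T f) = _
    rw [hf, map_smul]
  rw [ContinuousLinearMap.orthogonalComplement_iSup_eigenspaces_eq_bot hTc hTs,
    Submodule.mem_bot] at h0
  -- Injectivity of `toL2` is not needed: `toL2 ω u = 0` makes `u` itself satisfy the eigenvalue
  -- equation with `μ = 0`, so `u` is energy-orthogonal to itself.
  refine eq_zero_of_energy_self hω hκ (hspan 0 u ?_)
  show inverseOp hω hκ (toL2 ω u) = _
  rw [h0, map_zero, zero_smul]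

/-- The eigenfunctions of `𝓛⁻¹` are complete in `H¹₀(ω)`. -/
theorem topologicalClosure_span_eigenfunctions {hω : Bornology.IsBounded ω}
    {hκ : IsPermeability ω κ} {lam : ℕ+ → ℝ} {φ : ℕ+ → H10 ω} (hφ : IsEigenpairs hω hκ lam φ) :
    (Submodule.span ℝ (Set.range φ)).topologicalClosure = ⊤ := by
  rw [Submodule.topologicalClosure_eq_top_iff, Submodule.eq_bot_iff]
  intro x hx
  have hE := energyForm_isCoercive hω hκ
  -- The Lax–Milgram isomorphism turns orthogonality in the `H¹` inner product into orthogonality in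
  -- the energy form.
  obtain ⟨u, rfl⟩ := hE.continuousLinearEquivOfBilin.surjective x
  have : u = 0 := eq_zero_of_energy_eigenpairs_eq_zero hφ fun m => by
    rw [← energyForm_apply hκ, ← hE.continuousLinearEquivOfBilin_apply, real_inner_comm]
    exact hx _ (Submodule.subset_span ⟨m, rfl⟩)
  rw [this, map_zero]

theorem eigenvalue_nonneg {hω : Bornology.IsBounded ω}
    {hκ : IsPermeability ω κ} {lam : ℕ+ → ℝ} {φ : ℕ+ → H10 ω} (hφ : IsEigenpairs hω hκ lam φ)
    (m : ℕ+) : 0 ≤ lam m := by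
  obtain ⟨h0, he⟩ := hφ.2.1 m
  have h1 : energy ω κ (localInverse hω hκ (φ m)) (φ m) = ⟪toL2 ω (φ m), toL2 ω (φ m)⟫_ℝ :=
    energy_inverseOp_eq_inner hω hκ _ _
  rw [he, energy_smul_left] at h1
  have h2 : 0 < energy ω κ (φ m) (φ m) := (energy_self_nonneg hω hκ _).lt_of_ne
    fun h => h0 (eq_zero_of_energy_self hω hκ h.symm)
  have h3 : 0 ≤ lam m * energy ω κ (φ m) (φ m) := h1 ▸ real_inner_self_nonneg
  exact nonneg_of_mul_nonneg_left h3 h2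

theorem aeval_sum_sub_of_apply_eq_smul {ι H : Type*} [DecidableEq ι] [NormedAddCommGroup H]
    [NormedSpace ℝ H] {T : H →L[ℝ] H} {φ : ι → H} {lam : ι → ℝ} (h : ∀ m, T (φ m) = lam m • φ m)
    {q : ℝ[X]} {j : ι} (hq : q.eval (lam j) = 1) {s : Finset ι} (hj : j ∈ s) (c : ι → ℝ) :
    aeval T q (∑ m ∈ s, c m • φ m) - c j • φ j =
      ∑ m ∈ s.erase j, (c m * q.eval (lam m)) • φ m := by
  rw [sub_eq_iff_eq_add, ← Finset.sum_erase_add _ _ hj, map_add, map_sum, map_smul,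
    aeval_apply_of_apply_eq_smul (h j), hq, one_smul]
  congr 1
  refine Finset.sum_congr rfl fun m _ => ?_
  rw [map_smul, aeval_apply_of_apply_eq_smul (h m), smul_smul]

/-- Spectral estimate for a polynomial `q` in `𝓛⁻¹` that picks out the `j`-th eigenfunction, on
finite linear combinations of eigenfunctions. -/
theorem energy_aeval_sum_sub_le {hω : Bornology.IsBounded ω}
    {hκ : IsPermeability ω κ} {lam : ℕ+ → ℝ} {φ : ℕ+ → H10 ω} (hφ : IsEigenpairs hω hκ lam φ)
    {j : ℕ+} {q : ℝ[X]} (hqj : q.eval (lam j) = 1) {M : ℝ}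
    (hM : ∀ m, m ≠ j → |q.eval (lam m)| ≤ M) {s : Finset ℕ+} (hj : j ∈ s) (c : ℕ+ → ℝ) :
    energy ω κ (aeval (localInverse hω hκ) q (∑ m ∈ s, c m • φ m) - c j • φ j)
      (aeval (localInverse hω hκ) q (∑ m ∈ s, c m • φ m) - c j • φ j) ≤
      M ^ 2 * energy ω κ (∑ m ∈ s, c m • φ m) (∑ m ∈ s, c m • φ m) := by
  rw [aeval_sum_sub_of_apply_eq_smul (fun m => (hφ.2.1 m).2) hqj hj,
    energy_sum_self hκ hφ.2.2.1, energy_sum_self hκ hφ.2.2.1, Finset.mul_sum]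
  refine (Finset.sum_le_sum fun m hm => ?_).trans
    (Finset.sum_le_sum_of_subset_of_nonneg (Finset.erase_subset j s) fun m _ _ => ?_)
  · rw [← mul_assoc]
    refine mul_le_mul_of_nonneg_right ?_ (energy_self_nonneg hω hκ _)
    rw [mul_pow, mul_comm, ← sq_abs (q.eval _)]
    have := hM m (Finset.ne_of_mem_erase hm)
    gcongr
  · have := energy_self_nonneg hω hκ (φ m)
    positivity

theorem energy_aeval_sub_le {hω : Bornology.IsBounded ω}
    {hκ : IsPermeability ω κ} {lam : ℕ+ → ℝ} {φ : ℕ+ → H10 ω} (hφ : IsEigenpairs hω hκ lam φ)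
    {j : ℕ+} {q : ℝ[X]} (hqj : q.eval (lam j) = 1) {M : ℝ}
    (hM : ∀ m, m ≠ j → |q.eval (lam m)| ≤ M) (ψ : H10 ω) :
    energy ω κ
      (aeval (localInverse hω hκ) q ψ - (energy ω κ ψ (φ j) / energy ω κ (φ j) (φ j)) • φ j)
      (aeval (localInverse hω hκ) q ψ - (energy ω κ ψ (φ j) / energy ω κ (φ j) (φ j)) • φ j) ≤
      M ^ 2 * energy ω κ ψ ψ := by
  refine bilin_sub_smul_le_of_span (energyForm hκ) (aeval (localInverse hω hκ) q) (φ j)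
    (energy ω κ (φ j) (φ j)) (M ^ 2) (topologicalClosure_span_eigenfunctions hφ)
    (fun c => ?_) ψ
  have hj0 : energy ω κ (φ j) (φ j) ≠ 0 :=
    fun h => (hφ.2.1 j).1 (eq_zero_of_energy_self hω hκ h)
  -- The index `j` may lie outside the support of `c`; inserting it adds a zero term.
  have hjs : j ∈ insert j c.support := Finset.mem_insert_self j c.support
  have hsum : (c.sum fun i a => a • φ i) = ∑ m ∈ insert j c.support, c m • φ m :=
    Finsupp.sum_of_support_subset c (Finset.subset_insert j _) _ (fun _ _ => zero_smul _ _)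
  have hcj : energyForm hκ (∑ m ∈ insert j c.support, c m • φ m) (φ j) / energy ω κ (φ j) (φ j) =
      c j := by
    rw [energyForm_apply, energy_sum_eigenfunction hκ hφ.2.2.1 hjs, mul_div_cancel_right₀ _ hj0]
  rw [hsum, hcj]
  exact energy_aeval_sum_sub_le hφ hqj hM hjs c

theorem aeval_mem_krylov (hω : Bornology.IsBounded ω) (hκ : IsPermeability ω κ) {k : ℕ} {q : ℝ[X]}
    (hq : q.natDegree < k) (ψ : H10 ω) : aeval (localInverse hω hκ) q ψ ∈ krylov hω hκ k ψ := by
  rw [aeval_eq_sum_range, sum_apply]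
  refine Submodule.sum_mem _ fun i hi => ?_
  rw [smul_apply]
  refine Submodule.smul_mem _ _ (Submodule.subset_span ⟨i, ?_, rfl⟩)
  have := Finset.mem_range.1 hi
  omega

end Completeness

/-! ### The filter polynomial and convergence -/

/-- A filter polynomial for the Krylov space: it equals `1` at `lam j`, and it is small at all
other `lam m`. -/
theorem exists_filter_polynomial {lam : ℕ+ → ℝ} (hanti : Antitone lam) (h0 : ∀ m, 0 ≤ lam m)
    {j : ℕ+} (hj : ∀ m < j, lam m ≠ lam j) (hpos : 0 < lam (j + 1))
    (hgap : lam (j + 1) < lam j) :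
    ∃ D : ℝ, ∀ k : ℕ, (j : ℕ) < k → ∃ q : ℝ[X], q.natDegree < k ∧ q.eval (lam j) = 1 ∧
      ∀ m, m ≠ j → |q.eval (lam m)| ≤ D * (1 / (1 + 4 * relGap lam j)) ^ k := by
  have hγ : 0 < relGap lam j := div_pos (sub_pos.2 hgap) hpos
  set r := 1 + 4 * relGap lam j with hr
  have hr0 : 0 < r := by linarith
  -- Kills the components before `j`; `hj` keeps it nonzero at `lam j`.
  let P : ℝ[X] := ∏ m ∈ Finset.Ico 1 j, (X - C (lam m))
  have hPev : ∀ x, P.eval x = ∏ m ∈ Finset.Ico 1 j, (x - lam m) := fun x => by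
    simp [P, eval_prod]
  have hPj : P.eval (lam j) ≠ 0 := by
    rw [hPev]
    exact Finset.prod_ne_zero_iff.2 fun m hm =>
      sub_ne_zero.2 (hj m (Finset.mem_Ico.1 hm).2).symm
  have hPdeg : P.natDegree = (j : ℕ) - 1 := by
    simp [P, natDegree_prod_of_monic _ _ fun m _ => monic_X_sub_C (lam m)]
  obtain ⟨D, hD⟩ := (isCompact_Icc (a := (0 : ℝ)) (b := lam (j + 1))).exists_bound_of_continuousOn
    P.continuous.continuousOn
  have hD0 : 0 ≤ D := (norm_nonneg _).trans (hD 0 ⟨le_rfl, hpos.le⟩)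
  -- The factor `2` comes from the Chebyshev lower bound, and `r ^ j` compensates for its degree
  -- being `k - j` rather than `k`.
  refine ⟨D / |P.eval (lam j)| * (2 * r ^ (j : ℕ)), fun k hk => ?_⟩
  -- The affine map taking `[0, lam (j + 1)]` onto `[-1, 1]`.
  let L : ℝ[X] := C (2 / lam (j + 1)) * X - 1
  have hLev : ∀ x, L.eval x = 2 / lam (j + 1) * x - 1 := fun x => by simp [L]
  have hLj : L.eval (lam j) = (1 + r) / 2 := by
    rw [hLev, hr, relGap]
    field_simp
    ring
  let t : ℝ[X] := (Chebyshev.T ℝ (k - j : ℕ)).comp L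
  have htj : r ^ (k - j : ℕ) / 2 ≤ t.eval (lam j) := by
    rw [eval_comp, hLj]
    exact pow_div_two_le_eval_T (by linarith) _
  have htj0 : 0 < t.eval (lam j) := lt_of_lt_of_le (by positivity) htj
  have htdeg : t.natDegree ≤ k - j := by
    refine natDegree_comp_le.trans ?_
    rw [Chebyshev.natDegree_T, Int.natAbs_natCast]
    have : L.natDegree ≤ 1 := by
      dsimp only [L]
      compute_degree
    exact (Nat.mul_le_mul_left _ this).trans_eq (mul_one _)
  refine ⟨C (P.eval (lam j) * t.eval (lam j))⁻¹ * (P * t), ?_, ?_, fun m hm => ?_⟩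
  -- The degrees add up to at most `(j - 1) + (k - j) = k - 1`.
  · refine lt_of_le_of_lt ((natDegree_C_mul_le _ _).trans natDegree_mul_le) ?_
    have := j.pos
    omega
  · rw [eval_mul, eval_C, eval_mul]
    exact inv_mul_cancel₀ (mul_ne_zero hPj htj0.ne')
  · rw [eval_mul, eval_C, eval_mul]
    rcases lt_or_gt_of_ne hm with hm | hm
    · have : P.eval (lam m) = 0 := by
        rw [hPev]
        exact Finset.prod_eq_zero (Finset.mem_Ico.2 ⟨one_le, hm⟩) (sub_self _)
      rw [this, zero_mul, mul_zero, abs_zero]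
      positivity
    · have hmj : lam m ≤ lam (j + 1) := hanti (PNat.add_one_le_iff.2 hm)
      have h1 : |P.eval (lam m)| ≤ D := hD _ ⟨h0 m, hmj⟩
      have h2 : |t.eval (lam m)| ≤ 1 := by
        rw [eval_comp]
        refine Chebyshev.abs_eval_T_real_le_one _ ?_
        rw [hLev, abs_le, div_mul_eq_mul_div]
        have h3 : 0 ≤ 2 * lam m / lam (j + 1) := by have := h0 m; positivity
        have h4 : 2 * lam m / lam (j + 1) ≤ 2 := by rw [div_le_iff₀ hpos]; linarith
        constructor <;> linarith
      rw [abs_mul, abs_inv, abs_mul, abs_mul, abs_of_pos htj0]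
      calc (|P.eval (lam j)| * t.eval (lam j))⁻¹ * (|P.eval (lam m)| * |t.eval (lam m)|)
          ≤ (|P.eval (lam j)| * (r ^ (k - j : ℕ) / 2))⁻¹ * (D * 1) := by gcongr
        _ = D / |P.eval (lam j)| * (2 * r ^ (j : ℕ)) * (1 / r) ^ k := by
          have : r ^ k = r ^ (k - j : ℕ) * r ^ (j : ℕ) := by
            rw [← pow_add, Nat.sub_add_cancel hk.le]
          rw [one_div, inv_pow, this]
          have := abs_pos.2 hPj
          field_simp

theorem energyNorm_smul {d : ℕ} {ω : Set (Space d)} {κ : Space d → ℝ} (c : ℝ) (u : H10 ω) :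
    energyNorm ω κ (c • u) = |c| * energyNorm ω κ u := by
  rw [energyNorm, energyNorm, energy_smul_left, energy_comm, energy_smul_left, ← mul_assoc, ← sq,
    Real.sqrt_mul (sq_nonneg c), Real.sqrt_sq_eq_abs]

end LKSI

end

theorem mainTheorem5 {d : ℕ} [NeZero d] {ω : Set (LKSI.Space d)} (hopen : IsOpen ω)
    (hω : Bornology.IsBounded ω) {κ : LKSI.Space d → ℝ} (hκ : LKSI.IsPermeability ω κ)
    {lam : ℕ+ → ℝ} {φ : ℕ+ → LKSI.H10 ω} (hφ : LKSI.IsEigenpairs hω hκ lam φ)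
    (j : ℕ+) (hj : ∀ m < j, lam m ≠ lam j)
    (ψ : LKSI.H10 ω) (hψ : LKSI.energy ω κ ψ (φ j) ≠ 0) :
    ∃ C : ℝ, ∀ k : ℕ, (j : ℕ) < k →
      ∃ φhat ∈ LKSI.krylov hω hκ k ψ,
        LKSI.energyNorm ω κ (φhat - φ j) ≤ C * (1 / (1 + 4 * LKSI.relGap lam j)) ^ k := by
  have hle : lam (j + 1) ≤ lam j := hφ.1 (PNat.lt_add_right j 1).le
  have h0 := LKSI.eigenvalue_nonneg hφ
  by_cases hgap : 0 < lam (j + 1) ∧ lam (j + 1) < lam j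
  · obtain ⟨D, hD⟩ := LKSI.exists_filter_polynomial hφ.1 h0 hj hgap.1 hgap.2
    set c := LKSI.energy ω κ ψ (φ j) / LKSI.energy ω κ (φ j) (φ j) with hc
    have hc0 : c ≠ 0 := div_ne_zero hψ
      fun h => (hφ.2.1 j).1 (LKSI.eq_zero_of_energy_self hω hκ h)
    refine ⟨|c⁻¹| * (D * LKSI.energyNorm ω κ ψ), fun k hk => ?_⟩
    obtain ⟨q, hqdeg, hqj, hq⟩ := hD k hk
    refine ⟨c⁻¹ • Polynomial.aeval (LKSI.localInverse hω hκ) q ψ,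
      Submodule.smul_mem _ _ (LKSI.aeval_mem_krylov hω hκ hqdeg ψ), ?_⟩
    set M := D * (1 / (1 + 4 * LKSI.relGap lam j)) ^ k with hM
    have hM0 : 0 ≤ M := (abs_nonneg _).trans (hq (j + 1) (PNat.lt_add_right j 1).ne')
    have h1 := Real.sqrt_le_sqrt (LKSI.energy_aeval_sub_le hφ hqj hq ψ)
    rw [Real.sqrt_mul (sq_nonneg M), Real.sqrt_sq hM0] at h1
    have h2 : c⁻¹ • Polynomial.aeval (LKSI.localInverse hω hκ) q ψ - φ j =
        c⁻¹ • (Polynomial.aeval (LKSI.localInverse hω hκ) q ψ - c • φ j) := by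
      rw [smul_sub, inv_smul_smul₀ hc0]
    rw [h2, LKSI.energyNorm_smul]
    calc _ ≤ |c⁻¹| * (M * LKSI.energyNorm ω κ ψ) := mul_le_mul_of_nonneg_left h1 (abs_nonneg _)
      _ = _ := by rw [hM]; ring
  -- Without a positive gap and a positive `lam (j + 1)`, the relative gap is `0`, in the case `lam
  -- (j + 1) = 0` by the convention `x / 0 = 0`. The claimed rate is then `1`, and the zero vector
  -- suffices.
  · have hrel : LKSI.relGap lam j = 0 := by
      rw [LKSI.relGap]
      rcases (h0 (j + 1)).eq_or_lt with h | h
      · rw [← h, div_zero]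
      · rw [le_antisymm hle (not_lt.1 fun h' => hgap ⟨h, h'⟩), sub_self, zero_div]
    refine ⟨LKSI.energyNorm ω κ (0 - φ j), fun k _ => ⟨0, Submodule.zero_mem _, ?_⟩⟩
    simp [hrel]
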